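/- Let $K$ be a quadratically closed field (every element of $K$ is a square in $K$) of characteristic different from $2$ and $3$. Let $G = \mathrm{SL}_2(K)$ and let $U = \left\{\begin{pmatrix}1&\lambda\\0&1\end{pmatrix} : \lambda \in K\right\} \le G$. For a $\mathbb{Z}[G]$-module $V$ and a subset $S \subseteq G$ write $C_V(S)$ for the subgroup of vectors of $V$ fixed by every element of $S$, and $C_V(u) = C_V(\{u\})$. Define subgroups of $V$ by $Z_0 = 0$ and $Z_{k+1}/Z_k = C_{V/Z_k}(U)$, i.e. $Z_{k+1} = \{v \in V : uv - v \in Z_k \text{ for all } u \in U\}$; the $U$-length of $V$ is the least $k$ (if any) such that $Z_k = V$. Let $V$ be a simple $\mathbb{Z}[G]$-module of $U$-length $3$ such that $C_V(u) = C_V(U)$ for every $u \in U \setminus \{1\}$. Then there exists a $K$-vector space structure on the abelian group $V$ for which $V$ is isomorphic to the adjoint module $\mathrm{Ad}\,\mathrm{PSL}_2(K)$; that is, there is a $K$-linear bijection $e$ from $V$ onto the space of $2\times 2$ matrices over $K$ of trace zero such that $e(g\cdot v) = g\, e(v)\, g^{-1}$ for all $g \in G$ and $v \in V$. -/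

import Mathlib

open scoped MatrixGroups MonoidAlgebra

/-- A field is quadratically closed if every element has a square root in it. -/
def IsQuadraticallyClosed (K : Type*) [Field K] : Prop :=
  ∀ a : K, ∃ b : K, b ^ 2 = a

section GroupModules

variable {G : Type*} [Group G] (V : Type*) [AddCommGroup V] [Module ℤ[G] V]

/-- `C_V(S)`: the subgroup of the vectors of the `ℤ[G]`-module `V` fixed by all elements of `S`. -/
def centralizerIn (S : Set G) : AddSubgroup V where
  carrier := {v | ∀ g ∈ S, MonoidAlgebra.of ℤ G g • v = v}
  zero_mem' := fun _ _ => smul_zero _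
  add_mem' := fun ha hb g hg => by rw [smul_add, ha g hg, hb g hg]
  neg_mem' := fun ha g hg => by rw [smul_neg, ha g hg]

/-- The ascending series of the `U`-module `V`: `Z_0 = 0` and `Z_{k+1} / Z_k = C_{V / Z_k}(U)`.
A vector `v` lies in `Z_{k+1}` if and only if its class modulo `Z_k` is fixed by every `u ∈ U`,
that is, `u • v - v ∈ Z_k`. -/
def ascendingSeries (U : Subgroup G) : ℕ → AddSubgroup V
  | 0 => ⊥
  | k + 1 =>
    { carrier := {v | ∀ u ∈ U, MonoidAlgebra.of ℤ G u • v - v ∈ ascendingSeries U k}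
      zero_mem' := fun _ _ => by
        rw [smul_zero, sub_zero]
        exact zero_mem _
      add_mem' := fun ha hb u hu => by
        rw [smul_add, add_sub_add_comm]
        exact add_mem (ha u hu) (hb u hu)
      neg_mem' := fun ha u hu => by
        rw [smul_neg, ← neg_sub']
        exact neg_mem (ha u hu) }

/-- `V` has `U`-length `n`: `n` is the least `k` with `Z_k = V`. -/
def HasLength (U : Subgroup G) (n : ℕ) : Prop :=
  IsLeast {k : ℕ | ascendingSeries V U k = ⊤} n

end GroupModules

section SL2

variable (K : Type*) [Field K]

/-- The group `U` of the upper unitriangular matrices in `SL_2(K)`. -/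
def unipotentSubgroup : Subgroup SL(2, K) where
  carrier := {g | ∃ a : K, (g : Matrix (Fin 2) (Fin 2) K) = !![1, a; 0, 1]}
  one_mem' := ⟨0, by simp [Matrix.one_fin_two]⟩
  mul_mem' := by
    rintro g h ⟨a, ha⟩ ⟨b, hb⟩
    exact ⟨b + a, by simp [ha, hb]⟩
  inv_mem' := by
    rintro g ⟨a, ha⟩
    exact ⟨-a, by simp [Matrix.SpecialLinearGroup.coe_inv, ha, Matrix.adjugate_fin_two]⟩

/-- `sl_2(K)`, the `K`-vector space of the `2 × 2` matrices of trace zero. -/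
abbrev TracelessMatrix : Type _ :=
  LieAlgebra.SpecialLinear.sl (Fin 2) K

/-- The action of `SL_2(K)` on the `2 × 2` matrices of trace zero by conjugation,
`g • X = g X g⁻¹`. -/
def conjRep : Representation K SL(2, K) (TracelessMatrix K) where
  toFun g :=
    { toFun := fun X => ⟨(g : Matrix (Fin 2) (Fin 2) K) * X.1 *
          ((g⁻¹ : SL(2, K)) : Matrix (Fin 2) (Fin 2) K), by
        have hX : (X.1 : Matrix (Fin 2) (Fin 2) K).trace = 0 := X.2
        change ((g : Matrix (Fin 2) (Fin 2) K) * X.1 *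
          ((g⁻¹ : SL(2, K)) : Matrix (Fin 2) (Fin 2) K)).trace = 0
        rw [Matrix.trace_mul_cycle, ← Matrix.SpecialLinearGroup.coe_mul, inv_mul_cancel,
          Matrix.SpecialLinearGroup.coe_one, one_mul, hX]⟩
      map_add' := fun X Y => Subtype.ext (by simp [mul_add, add_mul])
      map_smul' := fun c X => Subtype.ext (by simp) }
  map_one' := LinearMap.ext fun X => Subtype.ext (by simp)
  map_mul' g h := LinearMap.ext fun X => Subtype.ext (by
    simp only [mul_inv_rev, Matrix.SpecialLinearGroup.coe_mul, Module.End.mul_apply,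
      LinearMap.coe_mk, AddHom.coe_mk, mul_assoc])

/-- The center of `SL_2(K)` acts trivially by conjugation. -/
theorem center_le_ker_conjRep :
    Subgroup.center SL(2, K) ≤ (conjRep K).ker := by
  intro g hg
  obtain ⟨r, -, hr⟩ := Matrix.SpecialLinearGroup.mem_center_iff.mp hg
  refine MonoidHom.mem_ker.mpr (LinearMap.ext fun X => Subtype.ext ?_)
  change (g : Matrix (Fin 2) (Fin 2) K) * X.1 *
    ((g⁻¹ : SL(2, K)) : Matrix (Fin 2) (Fin 2) K) = X.1
  rw [← hr, (Matrix.scalar_commute r (fun s => Commute.all r s) X.1).eq, hr, mul_assoc,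
    ← Matrix.SpecialLinearGroup.coe_mul, mul_inv_cancel, Matrix.SpecialLinearGroup.coe_one,
    mul_one]

/-- `Ad PSL_2(K)`, the adjoint representation: the action of `PSL_2(K)` by conjugation on the
`2 × 2` matrices of trace zero. -/
def adPSL : Representation K PSL(2, K) (TracelessMatrix K) :=
  QuotientGroup.lift (Subgroup.center SL(2, K)) (conjRep K) (center_le_ker_conjRep K)

end SL2

/-! Simplicity makes `End V` a division ring by Schur, so its center `A` is a field over which `V`
is a representation. Cubic nilpotence of `U`, with 2 and 3 nonzero in `K` and length not 2, forces 2
and 3 to be nonzero in `A`. Hence each `u_a` is `1 + x_a + x_a²/2` with `x` additive in `a`.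

Put `Z = C_V(U)`. By simplicity `Z ∩ wZ = 0`, and `-1` acts as a sign. On `z ∈ Z` the Bruhat form of
`w u_m w` is one identity in `V`; comparing it at `m` and `-m` separates even from odd terms. If
`-1` acts as `-1`, this yields `x_m w z = -t_m z`, so `Z + wZ` is a submodule on which `U` is
quadratic, which is impossible (`central_eq_one`).

If `-1` acts trivially, `t_m z = x_m² w z / 2`. Thus the torus acts on `Z` by a form quadratic in
`m` and multiplicative. Polarizing it, with `x_a w z = x_1 w λ_a z` for `λ_a = x_1 x_a w / 2`
(`apply_w`), shows that `a ↦ λ_a` is multiplicative on `Z` (`polar_one_mul`): this is the hidden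
action of `K`. For a nonzero `z ∈ Z`, the vectors `λ_q z`, `x_1 w λ_p z`, `w λ_r z` are then the
coordinates of a copy of the traceless matrices, which is all of `V` by simplicity. -/

/-! ### Consequences of the relations among `x`, `w` and `t` -/

section AbstractCubic

variable {K A V : Type*} [Field K] [Field A] [AddCommGroup V] [Module A V]

/-- The truncated exponential `1 + f + f ^ 2 / 2`. -/
def expTwo (f : Module.End A V) : Module.End A V := 1 + f + (2⁻¹ : A) • (f * f)

/-- Logarithms `x` of a one-parameter unipotent group acting with cubic nilpotence, together with
the action `w` of the Weyl element and `t` of the torus; the central involution acts as `ε`. -/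
structure CubicData (x : K →+ Module.End A V) (w : Module.End A V) (t : Kˣ →* Module.End A V)
    (ε : ℤˣ) : Prop where
  two_ne_zero : (2 : A) ≠ 0
  three_ne_zero : (3 : A) ≠ 0
  comm : ∀ a b v, x a (x b v) = x b (x a v)
  cube : ∀ a b c v, x a (x b (x c v)) = 0
  ker : ∀ a v, a ≠ 0 → x a v = 0 → ∀ b, x b v = 0
  w_sq : ∀ v, w (w v) = (ε : ℤ) • v
  disjoint : ∀ v, (∀ a, x a v = 0) → (∀ a, x a (w v) = 0) → v = 0
  t_fixed : ∀ m v, (∀ a, x a v = 0) → ∀ a, x a (t m v) = 0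
  t_neg : ∀ m v, t (-m) v = (ε : ℤ) • t m v
  rel : ∀ (m : Kˣ) v, (∀ a, x a v = 0) →
    w (expTwo (x m) (w v)) = (ε : ℤ) • expTwo (x (-(m⁻¹ : Kˣ))) (w (t m v))

namespace CubicData

variable {x : K →+ Module.End A V} {w : Module.End A V} {t : Kˣ →* Module.End A V}

theorem expTwo_apply (f : Module.End A V) (v : V) :
    expTwo f v = v + f v + (2⁻¹ : A) • f (f v) := by
  simp [expTwo]

/-! ### The central involution acts as `-1` -/

section Odd

/-- The operator `x_{1/m}² w t_m / 2`. -/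
def obstruction (x : K →+ Module.End A V) (w : Module.End A V) (t : Kˣ →* Module.End A V)
    (m : Kˣ) : Module.End A V :=
  (2⁻¹ : A) • (x (m⁻¹ : Kˣ) * x (m⁻¹ : Kˣ) * w * t m)

theorem obstruction_apply (m : Kˣ) (v : V) : obstruction x w t m v =
    (2⁻¹ : A) • x (m⁻¹ : Kˣ) (x (m⁻¹ : Kˣ) (w (t m v))) := rfl

variable (h : CubicData x w t (-1))
include h

theorem apply_w_aux (m : Kˣ) (z : V) (hz : ∀ a, x a z = 0) :
    x m (w z) = -t m z + w (obstruction x w t m z) := by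
  have h2 := h.two_ne_zero
  have e1 := h.rel m z hz
  have e2 := h.rel (-m) z hz
  have hinj : ∀ v, w (w v) = -v := fun v => by simpa using h.w_sq v
  simp only [expTwo_apply, h.t_neg, Units.val_neg, inv_neg, neg_neg, map_neg, map_add, map_smul,
    hinj, LinearMap.neg_apply, smul_neg, Int.reduceNeg, Units.val_one, neg_smul, one_smul] at e1 e2
  have e3 : w (x m (w z)) = w (-t m z + w (obstruction x w t m z)) := by
    rw [map_add, hinj, obstruction_apply, map_neg]
    have : (2 : A) • (w (x m (w z)) + w (t m z) +
        (2⁻¹ : A) • x (m⁻¹ : Kˣ) (x (m⁻¹ : Kˣ) (w (t m z)))) = 0 := by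
      -- Since `t (-m) = -t m` here, subtracting the relation at `-m` cancels the terms `w (w z)`
      -- and `x_m²` on the left, and the linear term in `x_{1/m}` on the right.
      linear_combination (norm := match_scalars <;> field_simp <;> ring) e1 - e2
    have := (smul_eq_zero_iff_right h2).1 this
    linear_combination (norm := match_scalars <;> field_simp <;> ring) this
  have := congrArg w e3
  rw [hinj, hinj] at this
  exact neg_injective this

theorem obstruction_fixed (m : Kˣ) (z : V) (a : K) : x a (obstruction x w t m z) = 0 := by
  rw [obstruction_apply, map_smul, h.cube, smul_zero]

/-- Applying `apply_w_aux` twice leaves an extra term `w y'`, with `y'` the obstruction iterated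
twice. Cubic nilpotence makes `w y'` fixed as well as `y'`, so `y' = 0` by `disjoint`. -/
theorem sq_apply_w (m : Kˣ) (z : V) (hz : ∀ a, x a z = 0) :
    x m (x m (w z)) = -t m (obstruction x w t m z) := by
  set y := obstruction x w t m z with hy
  have hyf : ∀ a, x a y = 0 := h.obstruction_fixed m z
  have e1 : x m (x m (w z)) = -t m y + w (obstruction x w t m y) := by
    rw [h.apply_w_aux m z hz, map_add, map_neg, h.t_fixed m z hz, neg_zero, zero_add,
      h.apply_w_aux m y hyf]
  have : obstruction x w t m y = 0 := by
    refine h.disjoint _ (h.obstruction_fixed m y) fun a => ?_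
    have := congrArg (x a) e1
    rw [h.cube, map_add, map_neg, h.t_fixed m y hyf, neg_zero, zero_add] at this
    exact this.symm
  rw [e1, this, map_zero, add_zero]

/-- By `sq_apply_w`, twice the obstruction at `m` is minus its torus conjugate at `m⁻¹`. Using this
again at `m⁻¹` gives four times the obstruction equal to itself, and 3 is invertible. -/
theorem obstruction_eq_zero (m : Kˣ) (z : V) (hz : ∀ a, x a z = 0) :
    obstruction x w t m z = 0 := by
  have h2 := h.two_ne_zero
  have key : ∀ (n : Kˣ) y, (∀ a, x a y = 0) → (2 : A) • obstruction x w t n y =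
      -t n⁻¹ (obstruction x w t n⁻¹ (t n y)) := by
    intro n y hy
    rw [← h.sq_apply_w n⁻¹ _ (h.t_fixed n y hy), obstruction_apply, smul_smul,
      mul_inv_cancel₀ h2, one_smul]
  have tt : ∀ (n : Kˣ) v, t n⁻¹ (t n v) = v := fun n v => by
    rw [← Module.End.mul_apply, ← map_mul]; simp
  have e1 := key m z hz
  have e2 := key m⁻¹ (t m z) (h.t_fixed m z hz)
  rw [inv_inv, tt] at e2
  have e3 := congrArg (t m⁻¹) e2
  rw [map_smul, map_neg, tt] at e3
  have : (3 : A) • obstruction x w t m z = 0 := by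
    linear_combination (norm := match_scalars <;> field_simp <;> ring) (2 : A) • e1 - e3
  exact (smul_eq_zero_iff_right h.three_ne_zero).1 this

theorem apply_w_of_odd (m : Kˣ) (z : V) (hz : ∀ a, x a z = 0) : x m (w z) = -t m z := by
  rw [h.apply_w_aux m z hz, h.obstruction_eq_zero m z hz, map_zero, add_zero]

end Odd

/-! ### The central involution acts trivially: the action of `K` on fixed vectors -/

section Even

/-- The operator `x_a x_b w / 2`. -/
def polar (x : K →+ Module.End A V) (w : Module.End A V) (a b : K) : Module.End A V :=
  (2⁻¹ : A) • (x a * x b * w)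

theorem polar_apply (a b : K) (v : V) : polar x w a b v = (2⁻¹ : A) • x a (x b (w v)) := rfl

theorem polar_add_right (a b c : K) (v : V) :
    polar x w a (b + c) v = polar x w a b v + polar x w a c v := by
  simp [polar_apply]

theorem polar_add_left (a b c : K) (v : V) :
    polar x w (a + b) c v = polar x w a c v + polar x w b c v := by
  simp [polar_apply]

theorem polar_neg_right (a b : K) (v : V) : polar x w a (-b) v = -polar x w a b v := by
  simp [polar_apply]

theorem polar_sub_right (a b c : K) (v : V) :
    polar x w a (b - c) v = polar x w a b v - polar x w a c v := by
  rw [sub_eq_add_neg, polar_add_right, polar_neg_right, sub_eq_add_neg]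

variable (h : CubicData x w t 1)
include h

theorem w_w (v : V) : w (w v) = v := by simpa using h.w_sq v

theorem polar_comm (a b : K) (v : V) : polar x w a b v = polar x w b a v := by
  simp [polar_apply, h.comm a b]

theorem polar_fixed (a b c : K) (v : V) : x c (polar x w a b v) = 0 := by
  rw [polar_apply, map_smul, h.cube, smul_zero]

theorem two_smul_polar (a b : K) (v : V) : (2 : A) • polar x w a b v = x a (x b (w v)) := by
  rw [polar_apply, smul_smul, mul_inv_cancel₀ h.two_ne_zero, one_smul]

/-- The sum of the relations at `m` and `-m` equates a fixed vector with the `w`-image of a fixed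
vector, so both vanish by `disjoint`; the difference is the second claim. -/
theorem even_part (m : Kˣ) (z : V) (hz : ∀ a, x a z = 0) :
    t m z = polar x w m m z ∧ w (x m (w z)) = -x (m⁻¹ : Kˣ) (w (t m z)) := by
  have h2 := h.two_ne_zero
  have e1 := h.rel m z hz
  have e2 := h.rel (-m) z hz
  simp only [expTwo_apply, h.t_neg, Units.val_neg, inv_neg, neg_neg, map_neg, map_add, map_smul,
    h.w_w, LinearMap.neg_apply, Units.val_one, one_smul] at e1 e2
  refine ⟨?_, (smul_right_injective V h2) ?_⟩
  · have e3 : (2 : A) • (z - polar x w (m⁻¹ : Kˣ) (m⁻¹ : Kˣ) (t m z) -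
        w (t m z - polar x w m m z)) = 0 := by
      rw [map_sub, polar_apply, polar_apply, map_smul]
      linear_combination (norm := match_scalars <;> field_simp <;> ring) e1 + e2
    have e4 := (smul_eq_zero_iff_right h2).1 e3
    refine sub_eq_zero.1 (h.disjoint _ (fun a => ?_) (fun a => ?_))
    · rw [map_sub, h.t_fixed m z hz, h.polar_fixed, sub_zero]
    · rw [← sub_eq_zero.1 e4, map_sub, hz, h.polar_fixed, sub_zero]
  · show (2 : A) • _ = (2 : A) • _
    linear_combination (norm := match_scalars <;> field_simp <;> ring) e1 - e2

/-- On fixed vectors the diagonal of `polar` is the torus action, which is a homomorphism. The next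
lemmas polarize this identity. -/
theorem polar_mul_self (a b : K) (z : V) (hz : ∀ a, x a z = 0) :
    polar x w (a * b) (a * b) z = polar x w a a (polar x w b b z) := by
  rcases eq_or_ne a 0 with rfl | ha
  · simp [polar_apply]
  rcases eq_or_ne b 0 with rfl | hb
  · simp [polar_apply]
  have e1 := (h.even_part (Units.mk0 b hb) z hz).1
  have e2 := (h.even_part (Units.mk0 a ha) _ (h.t_fixed (Units.mk0 b hb) z hz)).1
  have e3 := (h.even_part (Units.mk0 a ha * Units.mk0 b hb) z hz).1
  rw [map_mul, Module.End.mul_apply, e2, e1] at e3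
  exact e3.symm

theorem polar_add_self (a b : K) (v : V) : polar x w (a + b) (a + b) v =
    polar x w a a v + polar x w b b v + (2 : A) • polar x w a b v := by
  rw [polar_add_left, polar_add_right, polar_add_right, h.polar_comm b a]
  module

theorem polar_mul_left (a b c : K) (z : V) (hz : ∀ a, x a z = 0) :
    polar x w (a * b) (a * c) z = polar x w a a (polar x w b c z) := by
  have e := h.polar_mul_self a (b + c) z hz
  rw [mul_add, h.polar_add_self, h.polar_add_self, map_add, map_add, map_smul,
    h.polar_mul_self a b z hz, h.polar_mul_self a c z hz] at e
  exact smul_right_injective V h.two_ne_zero (add_left_cancel e)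

theorem polar_mul_right (a b c : K) (z : V) (hz : ∀ a, x a z = 0) :
    polar x w (a * b) (a * c) z = polar x w b c (polar x w a a z) := by
  have e := h.polar_mul_self (b + c) a z hz
  rw [add_mul, h.polar_add_self, h.polar_add_self, h.polar_mul_self b a z hz,
    h.polar_mul_self c a z hz, mul_comm b, mul_comm c] at e
  exact smul_right_injective V h.two_ne_zero (add_left_cancel e)

theorem polar_one_one (z : V) (hz : ∀ a, x a z = 0) : polar x w 1 1 z = z := by
  simpa using (h.even_part 1 z hz).1.symm

theorem w_apply_one (z : V) (hz : ∀ a, x a z = 0) : w (x 1 (w z)) = -x 1 (w z) := by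
  simpa using (h.even_part 1 z hz).2

/-- The difference of the two sides is killed by `x 1`, and so is its `w`-image; `ker` turns this
into two fixed vectors and `disjoint` applies. -/
theorem apply_w (a : K) (z : V) (hz : ∀ a, x a z = 0) :
    x a (w z) = x 1 (w (polar x w 1 a z)) := by
  rcases eq_or_ne a 0 with rfl | ha
  · simp [polar_apply]
  lift a to Kˣ using ha.isUnit
  have hp := fun b => h.polar_fixed 1 a b z
  refine sub_eq_zero.1 (h.disjoint _ (h.ker 1 _ one_ne_zero ?_) (h.ker 1 _ one_ne_zero ?_))
  · rw [map_sub, ← h.two_smul_polar, ← h.two_smul_polar, h.polar_one_one _ hp, sub_self]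
  · rw [map_sub, (h.even_part a z hz).2, h.w_apply_one _ hp, map_sub, map_neg, map_neg,
      ← h.two_smul_polar, ← h.two_smul_polar, h.polar_one_one _ hp, (h.even_part a z hz).1,
      ← h.polar_mul_right _ _ _ z hz]
    simp [h.polar_comm 1]

theorem polar_eq (a b : K) (z : V) (hz : ∀ a, x a z = 0) :
    polar x w a b z = polar x w 1 a (polar x w 1 b z) := by
  rw [polar_apply, h.apply_w b z hz, ← polar_apply, h.polar_comm]

/-- Computing `polar a (a * b)` in two ways gives the identity after applying `polar 1 a`. That
operator is injective on fixed vectors, because its square is `polar a a`, the action of the torus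
element `a`. -/
theorem polar_one_mul (a b : K) (z : V) (hz : ∀ a, x a z = 0) :
    polar x w 1 (a * b) z = polar x w 1 a (polar x w 1 b z) := by
  rcases eq_or_ne a 0 with rfl | ha
  · simp [polar_apply]
  have inj : ∀ v, (∀ c, x c v = 0) → polar x w 1 a v = 0 → v = 0 := by
    intro v hv h0
    have := h.polar_eq a a v hv
    rw [h0, map_zero] at this
    have e := h.polar_mul_self a⁻¹ a v hv
    rwa [this, map_zero, inv_mul_cancel₀ ha, h.polar_one_one v hv] at e
  have hp := h.polar_fixed
  refine sub_eq_zero.1 (inj _ (fun c => by rw [map_sub, hp, hp, sub_zero]) ?_)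
  have e := h.polar_mul_left a 1 b z hz
  rw [mul_one, h.polar_eq a _ z hz, h.polar_eq a a _ (fun c => hp _ _ _ _)] at e
  rw [map_sub, e, sub_self]

end Even

end CubicData

end AbstractCubic

/-! ### Generators and relations of `SL_2(K)` -/

section Generators

variable {K : Type*} [Field K]

namespace SL2

/-- The upper unitriangular matrix with parameter `a`. -/
def upper (a : K) : SL(2, K) := ⟨!![1, a; 0, 1], by simp⟩

/-- The Weyl element. -/
def weyl : SL(2, K) := ⟨!![0, 1; -1, 0], by simp⟩

theorem coe_upper (a : K) : (upper a : Matrix (Fin 2) (Fin 2) K) = !![1, a; 0, 1] := rfl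

theorem coe_weyl : ((weyl : SL(2, K)) : Matrix (Fin 2) (Fin 2) K) = !![0, 1; -1, 0] := rfl

/-- The diagonal matrices of determinant one. -/
def torus : Kˣ →* SL(2, K) where
  toFun m := ⟨!![(m : K), 0; 0, (m⁻¹ : Kˣ)], by simp⟩
  map_one' := Subtype.ext (by simp [Matrix.one_fin_two])
  map_mul' m n := Subtype.ext (by
    refine Eq.trans ?_ (Matrix.SpecialLinearGroup.coe_mul _ _).symm
    simp [mul_comm])

theorem coe_torus (m : Kˣ) :
    (torus m : Matrix (Fin 2) (Fin 2) K) = !![(m : K), 0; 0, (m⁻¹ : Kˣ)] := rfl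

theorem upper_add (a b : K) : upper (a + b) = upper a * upper b :=
  Subtype.ext (by simp [coe_upper, add_comm])

theorem upper_zero : upper (0 : K) = 1 := Subtype.ext (by simp [coe_upper, Matrix.one_fin_two])

theorem weyl_mul_weyl : (weyl : SL(2, K)) * weyl = -1 :=
  Subtype.ext (by simp [coe_weyl, Matrix.one_fin_two])

theorem torus_neg (m : Kˣ) : torus (-m) = -1 * torus m := Subtype.ext (by simp [coe_torus])

theorem upper_mul_torus (m : Kˣ) (a : K) :
    upper a * torus m = torus m * upper ((m⁻¹ : Kˣ) * (m⁻¹ : Kˣ) * a) :=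
  Subtype.ext (by simp [coe_upper, coe_torus]; field_simp)

/-- The source of `CubicData.rel`: on a `U`-fixed vector the rightmost factor disappears. -/
theorem weyl_upper_weyl (m : Kˣ) : weyl * upper (m : K) * weyl =
    -1 * (upper (-((m⁻¹ : Kˣ) : K)) * weyl * torus m * upper (-((m⁻¹ : Kˣ) : K))) :=
  Subtype.ext (by simp [coe_upper, coe_torus, coe_weyl])

theorem torus_eq (m : Kˣ) : torus m =
    upper (m : K) * weyl * upper ((m⁻¹ : Kˣ) : K) * weyl⁻¹ * upper (m : K) * weyl⁻¹ :=
  Subtype.ext (by simp [coe_upper, coe_torus, coe_weyl, Matrix.SpecialLinearGroup.coe_inv,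
    Matrix.adjugate_fin_two])

/-- Bruhat decomposition: the big cell is a nonzero lower left entry, and multiplication by `weyl`
moves every other matrix into it. -/
theorem closure_eq_top : Subgroup.closure (insert weyl (Set.range (upper (K := K)))) = ⊤ := by
  set H := Subgroup.closure (insert weyl (Set.range (upper (K := K))))
  have hw : weyl ∈ H := Subgroup.subset_closure (Set.mem_insert _ _)
  have hu : ∀ a, upper a ∈ H := fun a => Subgroup.subset_closure (Or.inr ⟨a, rfl⟩)
  have ht : ∀ m, torus m ∈ H := fun m => by
    rw [torus_eq]
    exact mul_mem (mul_mem (mul_mem (mul_mem (mul_mem (hu _) hw) (hu _)) (inv_mem hw)) (hu _))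
      (inv_mem hw)
  have main : ∀ g : SL(2, K), g.1 1 0 ≠ 0 → g ∈ H := by
    intro g hg
    have hd := g.2
    rw [Matrix.det_fin_two] at hd
    have : g = upper (g.1 0 0 / g.1 1 0) * weyl *
        torus (Units.mk0 (-g.1 1 0) (neg_ne_zero.2 hg)) * upper (g.1 1 1 / g.1 1 0) := by
      refine Subtype.ext ?_
      simp only [Matrix.SpecialLinearGroup.coe_mul, coe_upper, coe_torus, coe_weyl]
      ext i j; fin_cases i <;> fin_cases j <;> simp <;> field_simp
      linear_combination -hd
    rw [this]
    exact mul_mem (mul_mem (mul_mem (hu _) hw) (ht _)) (hu _)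
  refine eq_top_iff.2 fun g _ => ?_
  by_cases hg : g.1 1 0 = 0
  · refine (Subgroup.mul_mem_cancel_left H hw).1 (main (weyl * g) ?_)
    have hd := g.2
    rw [Matrix.det_fin_two, hg, mul_zero, sub_zero] at hd
    have : g.1 0 0 ≠ 0 := left_ne_zero_of_mul_eq_one hd
    rw [Matrix.SpecialLinearGroup.coe_mul, coe_weyl]
    simpa [Matrix.mul_apply] using this
  · exact main g hg

end SL2

end Generators

/-! ### Logarithm of `U` and determination of the central sign -/

section Logarithm

variable {K A V : Type*} [Field K] [Field A] [AddCommGroup V] [Module A V]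

open SL2

/-- The nilpotent operator `u_a - 1`. -/
def upperSubOne (ρ : Representation A SL(2, K) V) (a : K) : Module.End A V := ρ (upper a) - 1

theorem upperSubOne_apply (ρ : Representation A SL(2, K) V) (a : K) (v : V) :
    upperSubOne ρ a v = ρ (upper a) v - v := rfl

theorem upperSubOne_add (ρ : Representation A SL(2, K) V) (a b : K) : upperSubOne ρ (a + b) =
    upperSubOne ρ a + upperSubOne ρ b + upperSubOne ρ a * upperSubOne ρ b := by
  simp only [upperSubOne, upper_add, map_mul]; noncomm_ring

theorem upperSubOne_comm (ρ : Representation A SL(2, K) V) (a b : K) :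
    upperSubOne ρ a * upperSubOne ρ b = upperSubOne ρ b * upperSubOne ρ a := by
  have e : ρ (upper a) * ρ (upper b) = ρ (upper b) * ρ (upper a) := by
    rw [← map_mul, ← map_mul, ← upper_add, ← upper_add, add_comm]
  simp only [upperSubOne, mul_sub, sub_mul, one_mul, mul_one, e]
  abel

/-- A simple representation of `SL(2, K)` on which the upper unipotent group acts with cubic,
not quadratic, nilpotence, all its nontrivial elements having the same fixed vectors. -/
structure IsCubicRep (ρ : Representation A SL(2, K) V) : Prop where
  two_ne_zero : (2 : A) ≠ 0
  three_ne_zero : (3 : A) ≠ 0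
  cube : ∀ a b c, upperSubOne ρ a * upperSubOne ρ b * upperSubOne ρ c = 0
  fixed : ∀ a v, a ≠ 0 → upperSubOne ρ a v = 0 → ∀ b, upperSubOne ρ b v = 0
  simple : ∀ W : AddSubgroup V, (∀ g, ∀ v ∈ W, ρ g v ∈ W) → W = ⊥ ∨ W = ⊤
  not_quadratic : ∃ a b, upperSubOne ρ a * upperSubOne ρ b ≠ 0

namespace IsCubicRep

variable {ρ : Representation A SL(2, K) V} (h : IsCubicRep ρ)

include h

/-- The logarithm of the upper unipotent group. -/
def log : K →+ Module.End A V where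
  toFun a := upperSubOne ρ a - (2⁻¹ : A) • (upperSubOne ρ a * upperSubOne ρ a)
  map_zero' := by simp [upperSubOne, upper_zero]
  map_add' a b := by
    have h2 := h.two_ne_zero
    rw [upperSubOne_add]
    simp only [mul_add, add_mul, ← mul_assoc, h.cube, upperSubOne_comm ρ b a, add_zero]
    match_scalars <;> field_simp
    all_goals norm_num

theorem log_apply (a : K) :
    h.log a = upperSubOne ρ a - (2⁻¹ : A) • (upperSubOne ρ a * upperSubOne ρ a) := rfl

theorem log_mul_log (a b : K) : h.log a * h.log b = upperSubOne ρ a * upperSubOne ρ b := by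
  simp only [log_apply, mul_sub, sub_mul, mul_smul_comm, smul_mul_assoc, ← mul_assoc, h.cube,
    smul_zero, sub_zero]

theorem log_cube (a b c : K) : h.log a * h.log b * h.log c = 0 := by
  rw [log_mul_log, log_apply]
  simp only [mul_sub, mul_smul_comm, ← mul_assoc, h.cube, zero_mul, smul_zero, sub_zero]

theorem exp_log (a : K) : expTwo (h.log a) = ρ (upper a) := by
  rw [expTwo, log_mul_log, log_apply, upperSubOne]
  abel

theorem log_eq_zero_iff (a : K) (v : V) : h.log a v = 0 ↔ upperSubOne ρ a v = 0 := by
  constructor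
  · intro hv
    rw [upperSubOne, ← h.exp_log, LinearMap.sub_apply, CubicData.expTwo_apply, hv]
    simp
  · intro hv
    rw [log_apply, LinearMap.sub_apply, LinearMap.smul_apply, Module.End.mul_apply, hv]
    simp

theorem rho_upper_eq (v : V) (hv : ∀ a, h.log a v = 0) (a : K) : ρ (upper a) v = v :=
  sub_eq_zero.1 ((h.log_eq_zero_iff a v).1 (hv a))

/-- A subgroup stable under the Weyl element and the upper unipotents is trivial. -/
theorem eq_bot_or_eq_top (W : AddSubgroup V) (hw : ∀ v ∈ W, ρ weyl v ∈ W)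
    (hu : ∀ a, ∀ v ∈ W, ρ (upper a) v ∈ W) : W = ⊥ ∨ W = ⊤ := by
  refine h.simple W fun g => ?_
  have hww : ∀ v ∈ W, ρ (weyl⁻¹) v ∈ W := fun v hv => by
    have e : (weyl⁻¹ : SL(2, K)) = weyl * weyl * weyl := by
      rw [inv_eq_iff_mul_eq_one, mul_assoc, ← mul_assoc, weyl_mul_weyl]
      simp
    rw [e, map_mul, map_mul]
    exact hw _ (hw _ (hw _ hv))
  have hg : g ∈ Subgroup.closure (insert weyl (Set.range (upper (K := K)))) := by
    rw [closure_eq_top]; trivial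
  induction hg using Subgroup.closure_induction'' with
  | mem y hy =>
    rcases hy with rfl | ⟨a, rfl⟩
    exacts [hw, hu a]
  | inv_mem y hy =>
    rcases hy with rfl | ⟨a, rfl⟩
    · exact hww
    · have : (upper a)⁻¹ = upper (-a) := by
        rw [inv_eq_iff_mul_eq_one, ← upper_add, add_neg_cancel, upper_zero]
      rw [this]
      exact hu (-a)
  | one => exact fun v hv => by simpa using hv
  | mul y z _ _ hy hz =>
    intro v hv
    rw [map_mul]
    exact hy _ (hz _ hv)

theorem exists_fixed_ne_zero : ∃ v, v ≠ 0 ∧ ∀ a, h.log a v = 0 := by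
  obtain ⟨a, b, hab⟩ := h.not_quadratic
  obtain ⟨v, hv⟩ := DFunLike.ne_iff.1 hab
  refine ⟨_, hv, fun c => ?_⟩
  rw [← h.log_mul_log, ← Module.End.mul_apply, ← mul_assoc, h.log_cube, LinearMap.zero_apply]

/-- The fixed space of the central involution is stable, so it is `V` or `0`; it contains every `v +
ρ (-1) v`. -/
theorem exists_central_sign : ∃ ε : ℤˣ, ∀ v, ρ (-1) v = (ε : ℤ) • v := by
  have hsq : ∀ v, ρ (-1) (ρ (-1) v) = v := fun v => by
    rw [← Module.End.mul_apply, ← map_mul]; simp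
  have hcomm : ∀ g v, ρ (-1) (ρ g v) = ρ g (ρ (-1) v) := fun g v => by
    rw [← Module.End.mul_apply, ← Module.End.mul_apply, ← map_mul, ← map_mul]; simp
  rcases h.simple (ρ (-1) - 1).toAddMonoidHom.ker (fun g v hv => by
      have hv : ρ (-1) v - v = 0 := hv
      show ρ (-1) (ρ g v) - ρ g v = 0
      rw [hcomm, ← map_sub, hv, map_zero]) with hb | hb
  · refine ⟨-1, fun v => ?_⟩
    have : ρ (-1) v + v ∈ (ρ (-1) - 1).toAddMonoidHom.ker := by
      show ρ (-1) (ρ (-1) v + v) - (ρ (-1) v + v) = 0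
      rw [map_add, hsq]; abel
    rw [hb] at this
    simpa using eq_neg_of_add_eq_zero_left this
  · refine ⟨1, fun v => ?_⟩
    have : v ∈ (ρ (-1) - 1).toAddMonoidHom.ker := by rw [hb]; trivial
    simpa using sub_eq_zero.1 (show ρ (-1) v - v = 0 from this)

theorem cubicData {ε : ℤˣ} (hε : ∀ v, ρ (-1) v = (ε : ℤ) • v) :
    CubicData h.log (ρ weyl) (ρ.comp torus) ε where
  two_ne_zero := h.two_ne_zero
  three_ne_zero := h.three_ne_zero
  comm a b v := by
    rw [← Module.End.mul_apply, ← Module.End.mul_apply, log_mul_log, log_mul_log, upperSubOne_comm]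
  cube a b c v := DFunLike.congr_fun (h.log_cube a b c) v
  ker a v ha hv b := (h.log_eq_zero_iff b v).2 (h.fixed a v ha ((h.log_eq_zero_iff a v).1 hv) b)
  w_sq v := by rw [← hε, ← weyl_mul_weyl, map_mul]; rfl
  disjoint v hv hv' := by
    obtain ⟨z, hz, -⟩ := h.exists_fixed_ne_zero
    by_contra hne
    -- `W` is the intersection of `C_V(U)` with its Weyl translate. It is stable, and it is not `V`,
    -- since `U` acts nontrivially.
    set W : AddSubgroup V := ⨅ a, (h.log a).toAddMonoidHom.ker ⊓
      (h.log a * ρ weyl).toAddMonoidHom.ker with hW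
    have mem : ∀ v, v ∈ W ↔ ∀ a, h.log a v = 0 ∧ h.log a (ρ weyl v) = 0 := fun v => by
      rw [hW, AddSubgroup.mem_iInf]; rfl
    have hvW : v ∈ W := (mem v).2 fun a => ⟨hv a, hv' a⟩
    rcases h.eq_bot_or_eq_top W
      (fun y hy => (mem _).2 fun a => ⟨((mem y).1 hy a).2, by
        rw [← Module.End.mul_apply (ρ weyl), ← map_mul, weyl_mul_weyl, hε, map_zsmul,
          ((mem y).1 hy a).1, smul_zero]⟩)
      (fun a y hy => by rwa [h.rho_upper_eq y fun b => ((mem y).1 hy b).1]) with hb | hb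
    · rw [hb] at hvW
      exact hne hvW
    · obtain ⟨a, b, hab⟩ := h.not_quadratic
      refine hab (LinearMap.ext fun y => ?_)
      have : y ∈ W := by rw [hb]; trivial
      rw [Module.End.mul_apply, (h.log_eq_zero_iff b y).1 ((mem y).1 this b).1, map_zero]
      rfl
  t_fixed m v hv a := by
    rw [log_eq_zero_iff, upperSubOne_apply]
    show ρ (upper a) (ρ (torus m) v) - ρ (torus m) v = 0
    rw [← Module.End.mul_apply, ← map_mul, upper_mul_torus, map_mul, Module.End.mul_apply,
      h.rho_upper_eq v hv, sub_self]
  t_neg m v := by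
    show ρ (torus (-m)) v = (ε : ℤ) • ρ (torus m) v
    rw [torus_neg, map_mul, Module.End.mul_apply, hε]
  rel m v hv := by
    rw [exp_log, exp_log, ← Module.End.mul_apply, ← Module.End.mul_apply, ← map_mul, ← map_mul,
      weyl_upper_weyl, map_mul, Module.End.mul_apply, hε]
    simp only [map_mul, Module.End.mul_apply, h.rho_upper_eq v hv]
    rfl

theorem central_eq_one (v : V) : ρ (-1) v = v := by
  obtain ⟨ε, hε⟩ := h.exists_central_sign
  rcases Int.units_eq_one_or ε with rfl | rfl
  · simpa using hε v
  exfalso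
  have d := h.cubicData hε
  obtain ⟨z, hz0, hz⟩ := h.exists_fixed_ne_zero
  -- `W = Z + wZ` for `Z = C_V(U)`; `apply_w_of_odd` makes it stable with quadratic `U`-action.
  set W : AddSubgroup V :=
    { carrier := {v | ∃ y z, (∀ a, h.log a y = 0) ∧ (∀ a, h.log a z = 0) ∧ v = y + ρ weyl z}
      zero_mem' := ⟨0, 0, by simp⟩
      add_mem' := by
        rintro _ _ ⟨y, z, hy, hz, rfl⟩ ⟨y', z', hy', hz', rfl⟩
        refine ⟨y + y', z + z', by simp [hy, hy'], by simp [hz, hz'], ?_⟩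
        rw [map_add]; abel
      neg_mem' := by
        rintro _ ⟨y, z, hy, hz, rfl⟩
        refine ⟨-y, -z, by simp [hy], by simp [hz], ?_⟩
        rw [map_neg]; abel } with hW
  have hlog : ∀ a z, (∀ a, h.log a z = 0) → ∀ b, h.log b (h.log a (ρ weyl z)) = 0 := by
    intro a z hz b
    rcases eq_or_ne a 0 with rfl | ha
    · simp
    · have := d.apply_w_of_odd (Units.mk0 a ha) z hz
      rw [Units.val_mk0] at this
      rw [this, map_neg, d.t_fixed _ _ hz, neg_zero]
  have key : ∀ a b, ∀ v ∈ W, h.log a (h.log b v) = 0 := by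
    rintro a b _ ⟨y, z, hy, hz, rfl⟩
    rw [map_add, hy, zero_add, hlog b z hz]
  rcases h.eq_bot_or_eq_top W
    (by
      rintro _ ⟨y, z, hy, hz, rfl⟩
      refine ⟨-z, y, by simp [hz], hy, ?_⟩
      rw [map_add, d.w_sq]; simp [add_comm])
    (by
      rintro a _ ⟨y, z, hy, hz, rfl⟩
      refine ⟨y + h.log a (ρ weyl z), z, fun b => ?_, hz, ?_⟩
      · rw [map_add, hy, hlog a z hz, add_zero]
      · rw [← h.exp_log, CubicData.expTwo_apply, map_add, hy, zero_add, hlog a z hz]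
        rw [smul_zero]; abel) with hb | hb
  · have : z ∈ W := ⟨z, 0, hz, by simp⟩
    rw [hb] at this
    exact hz0 this
  · obtain ⟨a, b, hab⟩ := h.not_quadratic
    refine hab (LinearMap.ext fun y => ?_)
    rw [← h.log_mul_log]
    exact key a b y (by rw [hb]; trivial)

theorem cubicData_one : CubicData h.log (ρ weyl) (ρ.comp torus) 1 :=
  h.cubicData fun v => by simpa using h.central_eq_one v

end IsCubicRep

end Logarithm

/-! ### Excluding characteristics 2 and 3 for the scalars -/

section Characteristic

variable {K A V : Type*} [Field K] [Field A] [AddCommGroup V] [Module A V]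
  {ρ : Representation A SL(2, K) V}
  (hcube : ∀ a b c, upperSubOne ρ a * upperSubOne ρ b * upperSubOne ρ c = 0)
include hcube

theorem upperSubOne_eq_zero_of_two (hK : (2 : K) ≠ 0) (hA : (2 : A) = 0) (a : K) :
    upperSubOne ρ a = 0 := by
  have dbl : ∀ b, upperSubOne ρ (b + b) = upperSubOne ρ b * upperSubOne ρ b := fun b => by
    rw [upperSubOne_add, ← two_smul A (upperSubOne ρ b), hA, zero_smul, zero_add]
  -- Doubling the parameter squares `u - 1` in characteristic 2; two doublings give a fourth power,
  -- which is zero.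
  have e : a = (a / 2 / 2 + a / 2 / 2) + (a / 2 / 2 + a / 2 / 2) := by field_simp; norm_num
  rw [e, dbl, dbl, ← mul_assoc, hcube, zero_mul]

theorem upperSubOne_eq_zero_of_three (hK : (3 : K) ≠ 0) (hA : (3 : A) = 0) (a : K) :
    upperSubOne ρ a = 0 := by
  have e : a = (a / 3 + a / 3) + a / 3 := by field_simp; norm_num
  rw [e, upperSubOne_add, upperSubOne_add]
  simp only [add_mul, hcube, add_zero]
  generalize upperSubOne ρ (a / 3) = f
  have : (3 : A) • (f + f * f) = 0 := by rw [hA, zero_smul]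
  rw [← this]
  module

end Characteristic

/-! ### Explicit formulas for the adjoint action -/

section AdjointMatrices

variable {K : Type*} [Field K]

open SL2

theorem TracelessMatrix.apply_one_one (M : TracelessMatrix K) : M.1 1 1 = -M.1 0 0 := by
  have : M.1.trace = 0 := M.2
  rw [Matrix.trace_fin_two] at this
  exact eq_neg_of_add_eq_zero_right this

theorem TracelessMatrix.eta (M : TracelessMatrix K) :
    M.1 = !![M.1 0 0, M.1 0 1; M.1 1 0, -M.1 0 0] := by
  rw [← TracelessMatrix.apply_one_one M]
  exact Matrix.eta_fin_two _

theorem conjRep_apply_coe (g : SL(2, K)) (M : TracelessMatrix K) :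
    (conjRep K g M).1 = g.1 * M.1 * (g⁻¹).1 := rfl

theorem conjRep_weyl (M : TracelessMatrix K) :
    (conjRep K weyl M).1 = !![-M.1 0 0, -M.1 1 0; -M.1 0 1, M.1 0 0] := by
  rw [conjRep_apply_coe, Matrix.SpecialLinearGroup.coe_inv, coe_weyl, Matrix.adjugate_fin_two]
  have e := TracelessMatrix.eta M
  generalize M.1 0 0 = p at e ⊢
  generalize M.1 0 1 = q at e ⊢
  generalize M.1 1 0 = r at e ⊢
  rw [e]
  simp

theorem conjRep_upper (a : K) (M : TracelessMatrix K) : (conjRep K (upper a) M).1 =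
    !![M.1 0 0 + a * M.1 1 0, M.1 0 1 + (-(2 * (a * M.1 0 0)) - a * (a * M.1 1 0));
      M.1 1 0, -(M.1 0 0 + a * M.1 1 0)] := by
  rw [conjRep_apply_coe, Matrix.SpecialLinearGroup.coe_inv, coe_upper, Matrix.adjugate_fin_two]
  have e := TracelessMatrix.eta M
  generalize M.1 0 0 = p at e ⊢
  generalize M.1 0 1 = q at e ⊢
  generalize M.1 1 0 = r at e ⊢
  rw [e]
  ext i j
  fin_cases i <;> fin_cases j <;> simp <;> ring

end AdjointMatrices

/-! ### Embedding of the traceless matrices into `V` -/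

section Adjoint

variable {K A V : Type*} [Field K] [Field A] [AddCommGroup V] [Module A V]
  {ρ : Representation A SL(2, K) V} (h : IsCubicRep ρ)

open SL2 CubicData

namespace IsCubicRep

include h

/-- The additive map from the traceless matrices to `V` sending the elementary matrix `E_01`
to the vector `z`. -/
def adjointMap (z : V) : TracelessMatrix K →+ V where
  toFun M := polar h.log (ρ weyl) 1 (M.1 0 1) z -
    h.log 1 (ρ weyl (polar h.log (ρ weyl) 1 (M.1 0 0) z)) -
    ρ weyl (polar h.log (ρ weyl) 1 (M.1 1 0) z)
  map_zero' := by simp [polar_apply]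
  map_add' M N := by
    have e : ∀ i j, (M + N).1 i j = M.1 i j + N.1 i j := fun _ _ => rfl
    simp only [e, polar_add_right, map_add]
    abel

theorem adjointMap_apply (z : V) (M : TracelessMatrix K) : h.adjointMap z M =
    polar h.log (ρ weyl) 1 (M.1 0 1) z -
    h.log 1 (ρ weyl (polar h.log (ρ weyl) 1 (M.1 0 0) z)) -
    ρ weyl (polar h.log (ρ weyl) 1 (M.1 1 0) z) := rfl

theorem adjointMap_weyl (z : V) (M : TracelessMatrix K) :
    h.adjointMap z (conjRep K weyl M) = ρ weyl (h.adjointMap z M) := by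
  have d := h.cubicData_one
  rw [adjointMap_apply, adjointMap_apply, conjRep_weyl]
  simp only [Matrix.of_apply, Matrix.cons_val', Matrix.cons_val_zero, Matrix.cons_val_one,
    Matrix.cons_val_fin_one, map_sub, d.w_w, polar_neg_right, map_neg,
    d.w_apply_one _ (d.polar_fixed _ _ · z)]
  abel

theorem adjointMap_upper (z : V) (hz : ∀ a, h.log a z = 0) (a : K) (M : TracelessMatrix K) :
    h.adjointMap z (conjRep K (upper a) M) = ρ (upper a) (h.adjointMap z M) := by
  have d := h.cubicData_one
  have hp := fun b c => d.polar_fixed 1 b c z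
  have e2 : ∀ b c, h.log b (ρ weyl (polar h.log (ρ weyl) 1 c z)) =
      h.log 1 (ρ weyl (polar h.log (ρ weyl) 1 (b * c) z)) := fun b c => by
    rw [d.apply_w b _ (hp c), ← d.polar_one_mul b c z hz]
  have e3 : ∀ b c, h.log b (h.log 1 (ρ weyl (polar h.log (ρ weyl) 1 c z))) =
      (2 : A) • polar h.log (ρ weyl) 1 (b * c) z := fun b c => by
    rw [d.comm, e2, ← d.two_smul_polar, d.polar_one_one _ (hp _)]
  rw [← h.exp_log, CubicData.expTwo_apply, adjointMap_apply, adjointMap_apply, conjRep_upper]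
  simp only [Matrix.of_apply, Matrix.cons_val', Matrix.cons_val_zero, Matrix.cons_val_one,
    Matrix.cons_val_fin_one, map_sub, map_add, polar_add_right, polar_sub_right, polar_neg_right,
    two_mul, hp, e2 a, e3 a, map_smul, smul_zero, map_zero]
  have h2 := h.two_ne_zero
  match_scalars <;> field_simp <;> ring

theorem adjointMap_equivariant (z : V) (hz : ∀ a, h.log a z = 0) (g : SL(2, K)) :
    ∀ M, h.adjointMap z (conjRep K g M) = ρ g (h.adjointMap z M) := by
  have hg : g ∈ Subgroup.closure (insert weyl (Set.range (upper (K := K)))) := by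
    rw [closure_eq_top]; trivial
  induction hg using Subgroup.closure_induction with
  | mem y hy =>
    rcases hy with rfl | ⟨a, rfl⟩
    exacts [h.adjointMap_weyl z, h.adjointMap_upper z hz a]
  | one => simp
  | mul y y' _ _ hy hy' =>
    intro M
    rw [map_mul, map_mul, Module.End.mul_apply, Module.End.mul_apply, hy, hy']
  | inv y _ hy =>
    intro M
    have := hy (conjRep K y⁻¹ M)
    rw [← Module.End.mul_apply, ← map_mul, mul_inv_cancel, map_one, Module.End.one_apply] at this
    rw [this, ← Module.End.mul_apply, ← map_mul, inv_mul_cancel, map_one, Module.End.one_apply]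

theorem adjointMap_injective {z : V} (hz0 : z ≠ 0) (hz : ∀ a, h.log a z = 0) :
    Function.Injective (h.adjointMap z) := by
  have d := h.cubicData_one
  have hp := fun b c => d.polar_fixed 1 b c z
  have inj : ∀ b, polar h.log (ρ weyl) 1 b z = 0 → b = 0 := by
    intro b hb
    by_contra hne
    have := d.polar_one_mul b⁻¹ b z hz
    rw [hb, map_zero, inv_mul_cancel₀ hne, d.polar_one_one z hz] at this
    exact hz0 this
  have one : ∀ b, h.log 1 (h.log 1 (ρ weyl (polar h.log (ρ weyl) 1 b z))) =
      (2 : A) • polar h.log (ρ weyl) 1 b z := fun b => by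
    rw [← d.two_smul_polar, d.polar_one_one _ (hp b)]
  rw [injective_iff_map_eq_zero]
  intro M hM
  rw [adjointMap_apply] at hM
  -- `x 1` lowers the filtration: its square isolates the lower left entry, then `x 1` itself the
  -- diagonal one.
  have h10 : M.1 1 0 = 0 := by
    have := congrArg (fun v => h.log 1 (h.log 1 v)) hM
    simp only [map_sub, hp, one, map_zero, map_neg, map_smul, smul_zero, zero_sub, neg_zero,
      neg_eq_zero] at this
    exact inj _ ((smul_eq_zero_iff_right h.two_ne_zero).1 this)
  have p0 : polar h.log (ρ weyl) 1 0 z = 0 := by simp [polar_apply]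
  rw [h10, p0, map_zero, sub_zero] at hM
  have h00 : M.1 0 0 = 0 := by
    have := congrArg (h.log 1) hM
    simp only [map_sub, hp, one, map_zero, zero_sub, neg_eq_zero] at this
    exact inj _ ((smul_eq_zero_iff_right h.two_ne_zero).1 this)
  rw [h00, p0, map_zero, map_zero, sub_zero] at hM
  have h01 := inj _ hM
  refine Subtype.ext (Matrix.ext fun i j => ?_)
  fin_cases i <;> fin_cases j <;> simp [h10, h00, h01, TracelessMatrix.apply_one_one]

/-- A cubic representation is the adjoint representation, up to an additive isomorphism. -/
theorem exists_addEquiv : ∃ e : V ≃+ TracelessMatrix K,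
    ∀ g v, e (ρ g v) = conjRep K g (e v) := by
  obtain ⟨z, hz0, hz⟩ := h.exists_fixed_ne_zero
  have hinj := h.adjointMap_injective hz0 hz
  have heq := h.adjointMap_equivariant z hz
  have hsurj : Function.Surjective (h.adjointMap z) := by
    rcases h.simple (h.adjointMap z).range (by
      rintro g _ ⟨M, rfl⟩
      exact ⟨_, heq g M⟩) with hb | hb
    · exfalso
      let E : TracelessMatrix K := ⟨!![0, 1; 0, 0], by
        show Matrix.trace (!![0, 1; 0, 0] : Matrix (Fin 2) (Fin 2) K) = 0
        simp [Matrix.trace_fin_two]⟩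
      have h0 : h.adjointMap z E = 0 := by
        have : h.adjointMap z E ∈ (h.adjointMap z).range := ⟨E, rfl⟩
        rwa [hb] at this
      have hE := hinj (h0.trans (map_zero _).symm)
      have := congrFun (congrFun (congrArg Subtype.val hE) 0) 1
      simp [E] at this
    · exact AddMonoidHom.range_eq_top.1 hb
  let f := AddEquiv.ofBijective (h.adjointMap z) ⟨hinj, hsurj⟩
  refine ⟨f.symm, fun g v => ?_⟩
  rw [AddEquiv.symm_apply_eq]
  have := heq g (f.symm v)
  exact (congrArg (ρ g) (f.apply_symm_apply v)).symm.trans this.symm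

end IsCubicRep

end Adjoint

/-! ### Schur scalars and the main theorem -/

section Scalars

/-- A `ℤ[G]`-module, as a representation over the center of its endomorphism ring. -/
noncomputable def centerRep (G V : Type*) [Group G] [AddCommGroup V] [Module ℤ[G] V] :
    Representation (Subring.center (Module.End ℤ[G] V)) G V where
  toFun g :=
    { toFun := fun v => MonoidAlgebra.of ℤ G g • v
      map_add' := smul_add _
      map_smul' := fun c v => (c.1.map_smul (MonoidAlgebra.of ℤ G g) v).symm }
  map_one' := LinearMap.ext fun v => by
    show MonoidAlgebra.of ℤ G 1 • v = v
    rw [map_one, one_smul]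
  map_mul' g g' := LinearMap.ext fun v => by
    show MonoidAlgebra.of ℤ G (g * g') • v = _
    rw [map_mul, mul_smul]; rfl

theorem eq_bot_or_eq_top_of_stable {G V : Type*} [Group G] [AddCommGroup V]
    [Module ℤ[G] V] [IsSimpleModule ℤ[G] V] (W : AddSubgroup V)
    (hW : ∀ g, ∀ v ∈ W, MonoidAlgebra.of ℤ G g • v ∈ W) : W = ⊥ ∨ W = ⊤ := by
  let W' : Submodule ℤ[G] V :=
    { W with
      smul_mem' := fun r v hv => by
        induction r using MonoidAlgebra.induction_on with
        | of g => exact hW g v hv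
        | add r s hr hs => rw [add_smul]; exact W.add_mem hr hs
        | smul n r hr => rw [smul_assoc]; exact W.zsmul_mem hr n }
  have : W'.toAddSubgroup = W := rfl
  rcases eq_bot_or_eq_top W' with hb | hb
  · left; rw [← this, hb]; rfl
  · right; rw [← this, hb]; rfl

end Scalars

open SL2 in
theorem upper_mem_unipotentSubgroup {K : Type*} [Field K] (a : K) :
    upper a ∈ unipotentSubgroup K := ⟨a, rfl⟩

open SL2 in
theorem exists_eq_upper {K : Type*} [Field K] {g : SL(2, K)} (hg : g ∈ unipotentSubgroup K) :
    ∃ a, g = upper a := by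
  obtain ⟨a, ha⟩ := hg
  exact ⟨a, Subtype.ext ha⟩

theorem mainTheorem3 (K : Type*) [Field K] (hK : IsQuadraticallyClosed K)
    (h2 : ringChar K ≠ 2) (h3 : ringChar K ≠ 3)
    (V : Type*) [AddCommGroup V] [Module ℤ[SL(2, K)] V] [IsSimpleModule ℤ[SL(2, K)] V]
    (hlen : HasLength V (unipotentSubgroup K) 3)
    (hcent : ∀ u ∈ unipotentSubgroup K, u ≠ 1 →
      centralizerIn V {u} = centralizerIn V (unipotentSubgroup K : Set SL(2, K))) :
    ∃ (_ : Module K V) (e : V ≃ₗ[K] TracelessMatrix K),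
      ∀ (g : SL(2, K)) (v : V),
        e (MonoidAlgebra.of ℤ SL(2, K) g • v) = adPSL K (QuotientGroup.mk g) (e v) := by
  classical
  let : DivisionRing (Module.End ℤ[SL(2, K)] V) := Module.End.instDivisionRing
  let : Field (Subring.center (Module.End ℤ[SL(2, K)] V)) := Subring.instField
  set ρ := centerRep SL(2, K) V
  have hcube : ∀ a b c, upperSubOne ρ a * upperSubOne ρ b * upperSubOne ρ c = 0 := by
    intro a b c
    refine LinearMap.ext fun v => ?_
    have hv : v ∈ ascendingSeries V (unipotentSubgroup K) 3 := by
      rw [show ascendingSeries V (unipotentSubgroup K) 3 = ⊤ from hlen.1]; trivial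
    exact hv _ (upper_mem_unipotentSubgroup c) _ (upper_mem_unipotentSubgroup b) _
      (upper_mem_unipotentSubgroup a)
  have hquad : ∃ a b, upperSubOne ρ a * upperSubOne ρ b ≠ 0 := by
    by_contra! hcon
    have h32 : 3 ≤ 2 := hlen.2 (by
      refine eq_top_iff.2 fun v _ => ?_
      intro u hu u' hu'
      obtain ⟨a, rfl⟩ := exists_eq_upper hu
      obtain ⟨b, rfl⟩ := exists_eq_upper hu'
      exact DFunLike.congr_fun (hcon b a) v)
    omega
  have hK2 : (2 : K) ≠ 0 := Ring.two_ne_zero h2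
  have hK3 : (3 : K) ≠ 0 := fun h => by
    have hdvd : ringChar K ∣ 3 := ringChar.dvd (by exact_mod_cast h)
    rcases (Nat.dvd_prime Nat.prime_three).1 hdvd with h1 | h1
    exacts [CharP.ringChar_ne_one h1, h3 h1]
  have hrep : IsCubicRep ρ :=
    { two_ne_zero := fun hA => by
        obtain ⟨a, b, hab⟩ := hquad
        exact hab (by rw [upperSubOne_eq_zero_of_two hcube hK2 hA, zero_mul])
      three_ne_zero := fun hA => by
        obtain ⟨a, b, hab⟩ := hquad
        exact hab (by rw [upperSubOne_eq_zero_of_three hcube hK3 hA, zero_mul])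
      cube := hcube
      fixed := fun a v ha hv b => by
        have hne : SL2.upper a ≠ 1 := fun h => ha (by
          simpa [SL2.coe_upper] using congrFun (congrFun (congrArg Subtype.val h) 0) 1)
        have hmem : v ∈ centralizerIn V {SL2.upper a} := by
          rintro _ rfl
          exact sub_eq_zero.1 hv
        rw [hcent _ (upper_mem_unipotentSubgroup a) hne] at hmem
        exact sub_eq_zero.2 (hmem _ (upper_mem_unipotentSubgroup b))
      simple := fun W hW => eq_bot_or_eq_top_of_stable W hW
      not_quadratic := hquad }
  obtain ⟨e, he⟩ := hrep.exists_addEquiv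
  -- The `K`-structure is transported through `e`, so `e` becomes linear by construction.
  let : SMul K V := ⟨fun c v => e.symm (c • e v)⟩
  have hs : ∀ (c : K) (v : V), e (c • v) = c • e v := fun c v => e.apply_symm_apply _
  let : Module K V := Function.Injective.module K e.toAddMonoidHom e.injective hs
  exact ⟨inferInstance, { e with map_smul' := hs }, he⟩
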